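/- **Setting.** The cuckoo hashing scheme $\mathsf{CH}(k,b,\ell,s)$ for $n$ items has a table of $b$ entries, split into $k$ disjoint sub-tables of $\lfloor b/k\rfloor$ entries, where each entry can hold $\ell$ items, together with a stash that holds $s$ items ($k,\ell\ge 1$, $s\ge 0$, $k\le b$). There are $k$ independent uniformly random hash functions, $H_j$ mapping identifiers to entries of the $j$-th sub-table; an item (identifier–value pair) with identifier $x$ may be stored in one of the $k\ell$ cells of the entries $H_1(x),\dots,H_k(x)$ or in the stash. The *query overhead* is the number $k\ell+s$ of these locations. A (possibly randomized) construction algorithm receives $H_1,\dots,H_k$ and $n$ items with distinct identifiers and outputs a table storing all of them in such locations, or fails ($\perp$). Consider a sequence of instances, all parameters $\lambda,n,k,b,\ell,s$ being functions of the index, with arbitrary construction algorithms, an identifier universe that is infinite or of size super-polynomial in the security parameter $\lambda$, and a non-empty value universe. The sequence is *$(\lambda,1/2)$-robust* if for every probabilistic adversary (a uniform algorithm) that is given $\lambda$ and the parameters $n,k,b,\ell,s$, has oracle access to $H_1,\dots,H_k$, and runs in time $\mathrm{poly}(\lambda)$, for all sufficiently large indices the probability that it outputs $n$ items with distinct identifiers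 on which the construction fails is at most $1/2$. **Theorem.** Suppose that $\lambda\ge n$, $k=O(\log\lambda)$, $b=O(n/\ell)$, and that $\mathsf{CH}(k,b,\ell,s)$ is $(\lambda,1/2)$-robust. Then the query overhead is $k\ell+s=\Omega(n)$. Moreover $s+\ell=\Omega(n)$ holds outside the trivial regime $k\ell+s\ge n$. That is, there is a constant $c>0$ such that for all sufficiently large indices $$k\ell+s\ \ge\ c\,n,\qquad\text{and}\qquad k\ell+s<n\ \Longrightarrow\ s+\ell\ \ge\ c\,n .$$ In particular, large stashes or large entries cannot give robustness with sub-linear query overhead. -/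

import Mathlib

open Filter Asymptotics MeasureTheory
open scoped ENNReal

namespace CuckooHashing

/-- The parameters of one instance of the cuckoo hashing scheme `CH(k, b, ℓ, s)`. Identifiers are
the natural numbers below `idBound`, values the natural numbers below `valBound`
(both universes may be infinite). -/
structure Params where
  /-- security parameter -/
  lam : ℕ
  /-- number of items to be stored -/
  n : ℕ
  /-- number of hash functions, and of disjoint sub-tables -/
  k : ℕ
  /-- number of entries -/
  b : ℕ
  /-- entry size: how many items an entry can hold -/
  ell : ℕ
  /-- stash size -/
  s : ℕ
  idBound : ℕ∞
  valBound : ℕ∞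
  one_le_k : 1 ≤ k
  one_le_ell : 1 ≤ ell
  k_le_b : k ≤ b
  one_le_valBound : 1 ≤ valBound

namespace Params

variable (P : Params)

/-- The identifier universe. -/
abbrev Id : Type := {x : ℕ // (x : ℕ∞) < P.idBound}

/-- The value universe. -/
abbrev Val : Type := {v : ℕ // (v : ℕ∞) < P.valBound}

/-- Items are identifier-value pairs. -/
abbrev Item : Type := P.Id × P.Val

/-- Number of entries in each of the `k` disjoint sub-tables. -/
def subSize : ℕ := P.b / P.k

theorem subSize_pos : 0 < P.subSize := Nat.div_pos P.k_le_b P.one_le_k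

instance : Nonempty (Fin P.subSize) := ⟨⟨0, P.subSize_pos⟩⟩

/-- The `k` hash functions: `H (x, j)` is the entry of the `j`-th sub-table that the `j`-th hash
function assigns to the identifier `x`. -/
abbrev HashFns : Type := P.Id × Fin P.k → Fin P.subSize

/-- Truly random hash functions: all hash values are independent and uniform. -/
noncomputable def hashMeasure : Measure P.HashFns :=
  Measure.infinitePi fun _ => (PMF.uniformOfFintype (Fin P.subSize)).toMeasure

/-- A location is one of the `ell` cells of an entry of a sub-table, or a cell of the stash. -/
abbrev Loc : Type := (Fin P.k × Fin P.subSize × Fin P.ell) ⊕ Fin P.s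

/-- A hash table: every location is empty or holds one item. -/
abbrev Table : Type := P.Loc → Option P.Item

variable {P}

/-- The locations where an item with identifier `x` may be stored, which are the locations that a
query for `x` has to look at: all cells of the `k` assigned entries, and the whole stash. -/
def probes (H : P.HashFns) (x : P.Id) : Finset P.Loc :=
  Finset.univ.filter fun p => ∀ j e c, p = Sum.inl (j, e, c) → e = H (x, j)

variable (P) in
/-- The number of locations to look at in a query (see `card_probes`). -/
def queryOverhead : ℕ := P.k * P.ell + P.s

theorem card_probes (H : P.HashFns) (x : P.Id) : (probes H x).card = P.queryOverhead := by
  classical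
  have h : probes H x =
      ((Finset.univ : Finset (Fin P.k × Fin P.ell)).image
        fun q => (Sum.inl (q.1, H (x, q.1), q.2) : P.Loc)) ∪ Finset.univ.image Sum.inr := by
    ext p
    rcases p with ⟨j, e, c⟩ | p
    · simp only [probes, Finset.mem_filter, Finset.mem_univ, true_and, Finset.mem_union,
        Finset.mem_image, Prod.exists, Sum.inl.injEq, Prod.mk.injEq, reduceCtorEq, and_false,
        exists_false, or_false]
      constructor
      · intro h
        exact ⟨j, c, rfl, (h j e c ⟨rfl, rfl, rfl⟩).symm, rfl⟩
      · rintro ⟨j', c', rfl, rfl, rfl⟩ j₂ e₂ c₂ ⟨rfl, rfl, rfl⟩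
        rfl
    · simp [probes]
  rw [h, Finset.card_union_of_disjoint, Finset.card_image_of_injective,
    Finset.card_image_of_injective]
  · simp [queryOverhead]
  · exact Sum.inr_injective
  · rintro ⟨a, b⟩ ⟨c, d⟩ h
    simp only [Sum.inl.injEq, Prod.mk.injEq] at h
    ext <;> simp [h]
  · rw [Finset.disjoint_left]
    simp

/-- `T` is a successful allocation of `X` according to `H`. -/
def Allocates (H : P.HashFns) (X : Finset P.Item) (T : P.Table) : Prop :=
  (∀ x ∈ X, ∃ p ∈ probes H x.1, T p = some x) ∧ ∀ p x, T p = some x → x ∈ X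

/-- `X` is a set of `n` items with pairwise distinct identifiers. -/
def IsInput (X : Finset P.Item) : Prop :=
  X.card = P.n ∧ ∀ x ∈ X, ∀ y ∈ X, x.1 = y.1 → x = y

end Params

/-- An infinite sequence of independent fair coin flips. -/
noncomputable def coinMeasure : Measure (ℕ → Bool) :=
  Measure.infinitePi fun _ => (PMF.uniformOfFintype Bool).toMeasure

/-- A construction algorithm of the scheme: from the hash functions, its own coin flips and the
items it produces a table that allocates the items, or fails (`none`, i.e. `⊥`). -/
structure Construction (P : Params) where
  construct : P.HashFns → (ℕ → Bool) → Finset P.Item → Option P.Table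
  sound : ∀ H c X T, P.IsInput X → construct H c X = some T → P.Allocates H X T

/-! ### Adversaries: probabilistic random access machines with a hash oracle -/

/-- Programs of a random access machine with registers `r 0, r 1, …` and an addressable memory,
which can flip fair coins and query the hash functions. The only arithmetic is addition and
truncated subtraction, so unit-cost polynomial time is the usual polynomial time. -/
inductive Prog where
  /-- `r d := c` -/
  | const (d c : ℕ)
  /-- `r d := r x + r y` -/
  | add (d x y : ℕ)
  /-- `r d := r x - r y` (truncated) -/
  | sub (d x y : ℕ)
  /-- `r d := mem (r x)` -/
  | load (d x : ℕ)
  /-- `mem (r x) := r y` -/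
  | store (x y : ℕ)
  /-- `r d :=` a fresh fair coin flip -/
  | flip (d : ℕ)
  /-- `r d :=` value of the hash function number `r j` at the identifier `r x` -/
  | hash (d j x : ℕ)
  /-- append the item with identifier `r x` and value `r v` to the output -/
  | emit (x v : ℕ)
  /-- first `p`, then `q` -/
  | seq (p q : Prog)
  /-- `p` if `r x ≠ 0`, and `q` otherwise -/
  | ite (x : ℕ) (p q : Prog)
  /-- repeat `p` as long as `r x ≠ 0` -/
  | while (x : ℕ) (p : Prog)

/-- The data of a running machine. -/
structure State where
  reg : ℕ → ℕ
  mem : ℕ → ℕ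
  /-- number of coins flipped so far -/
  flips : ℕ
  out : List (ℕ × ℕ)

/-- Write `v` into register `d`. -/
def State.set (σ : State) (d v : ℕ) : State := { σ with reg := Function.update σ.reg d v }

/-- One step of the machine with hash oracle `O` and coin flips `ω`. A configuration is the stack
of the programs that are still to be run, and the state; the machine has halted when the stack is
empty. -/
def step (O : ℕ → ℕ → ℕ) (ω : ℕ → Bool) : List Prog × State → List Prog × State
  | ([], σ) => ([], σ)
  | (.const d c :: K, σ) => (K, σ.set d c)
  | (.add d x y :: K, σ) => (K, σ.set d (σ.reg x + σ.reg y))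
  | (.sub d x y :: K, σ) => (K, σ.set d (σ.reg x - σ.reg y))
  | (.load d x :: K, σ) => (K, σ.set d (σ.mem (σ.reg x)))
  | (.store x y :: K, σ) => (K, { σ with mem := Function.update σ.mem (σ.reg x) (σ.reg y) })
  | (.flip d :: K, σ) =>
      (K, { σ with reg := Function.update σ.reg d (ω σ.flips).toNat, flips := σ.flips + 1 })
  | (.hash d j x :: K, σ) => (K, σ.set d (O (σ.reg j) (σ.reg x)))
  | (.emit x v :: K, σ) => (K, { σ with out := σ.out ++ [(σ.reg x, σ.reg v)] })
  | (.seq p q :: K, σ) => (p :: q :: K, σ)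
  | (.ite x p q :: K, σ) => ((if σ.reg x ≠ 0 then p else q) :: K, σ)
  | (.while x p :: K, σ) => (if σ.reg x ≠ 0 then p :: .while x p :: K else K, σ)

namespace Params

variable {P : Params}

/-- The oracle that answers hash queries (`0` if there is no such function or identifier). -/
def oracle (H : P.HashFns) (j x : ℕ) : ℕ :=
  open Classical in
  if h : (x : ℕ∞) < P.idBound ∧ j < P.k then (H (⟨x, h.1⟩, ⟨j, h.2⟩)).val else 0

variable (P) in
/-- The adversary is given the security parameter and the parameters of the scheme. -/
def initState : State where
  reg := fun r => [P.lam, P.n, P.k, P.b, P.ell, P.s].getD r 0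
  mem := fun _ => 0
  flips := 0
  out := []

/-- The configuration of the adversary `A` after `t` steps. -/
def run (A : Prog) (H : P.HashFns) (ω : ℕ → Bool) (t : ℕ) : List Prog × State :=
  (step (oracle H) ω)^[t] ([A], P.initState)

/-- `A` halts after at most `t` steps. -/
def HaltsWithin (A : Prog) (H : P.HashFns) (ω : ℕ → Bool) (t : ℕ) : Prop :=
  (run A H ω t).1 = []

/-- `A` halts and its output is the set of items `X`. -/
def Outputs (A : Prog) (H : P.HashFns) (ω : ℕ → Bool) (X : Finset P.Item) : Prop :=
  ∃ t, HaltsWithin A H ω t ∧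
    ∀ q : ℕ × ℕ, q ∈ (run A H ω t).2.out ↔ ∃ x ∈ X, (x.1.val, x.2.val) = q

/-- The event that `A` breaks the scheme: it outputs `n` items with distinct identifiers for which
the construction fails. The sample point consists of the hash functions, the coins of `A` and the
coins of the construction algorithm. -/
def breakEvent (C : Construction P) (A : Prog) :
    Set (P.HashFns × (ℕ → Bool) × (ℕ → Bool)) :=
  {ω | ∃ X, Outputs A ω.1 ω.2.1 X ∧ P.IsInput X ∧ C.construct ω.1 ω.2.2 X = none}

variable (P) in
/-- Hash functions, coins of the adversary and coins of the construction algorithm are drawn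
independently. -/
noncomputable def gameMeasure : Measure (P.HashFns × (ℕ → Bool) × (ℕ → Bool)) :=
  P.hashMeasure.prod (coinMeasure.prod coinMeasure)

end Params

/-- `A` runs in time polynomial in the security parameter on the instances `P i`, whatever the
hash functions and the coins. -/
def IsPolyTime (P : ℕ → Params) (A : Prog) : Prop :=
  ∃ C d : ℕ, ∀ᶠ i in atTop, ∀ (H : (P i).HashFns) (ω : ℕ → Bool),
    Params.HaltsWithin A H ω (C * (P i).lam ^ d)

/-- `(λ, ε)`-robustness of a sequence of instances: every (uniform, probabilistic) adversary that
runs in time `poly(λ)` makes the construction fail with probability at most `ε`, for all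
sufficiently large indices. -/
def Robust (P : ℕ → Params) (C : ∀ i, Construction (P i)) (ε : ℝ≥0∞) : Prop :=
  ∀ A : Prog, IsPolyTime P A →
    ∀ᶠ i in atTop, (P i).gameMeasure (Params.breakEvent (C i) A) ≤ ε

end CuckooHashing

namespace CuckooHashing

/-! ### A program logic for the machine -/

/-! The attack looks for items whose entries all lie in a small corner of the table. Fix a constant
a that is at least twice the constant in b = O(n/ℓ), and target the first t = max 1 (b / (a k))
entries of each sub-table. The targeted cells number at most bℓ/a ≤ n/2, or exactly kℓ when t = 1.
So if kℓ + s < n and s < n/2, no algorithm can store n items confined to the target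
(`Allocates.card_le`).

An identifier is confined with probability (t/⌊b/k⌋)^k ≥ (2a)^(-k), which is at least λ^(-e) for a
constant e because k = O(log λ). Among λ^(e+4) identifiers at least λ^4 are confined in expectation,
and by Chebyshev at least n ≤ λ of them are with probability at least 3/4 (`hashMeasure_card_lt_le`,
`half_lt_gameMeasure`). Robustness therefore forces s ≥ n/2 whenever kℓ + s < n, and both claims
follow with c = 1/2.

Adversaries are concrete machine programs, so the search is written as `attack`; its output and its
running time come from the `Wp` rules (`wp_attack`). -/

/-- Weakest precondition with a time bound: started in `σ`, the program `p` ends after at most `T`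
steps in a state that satisfies `Q`. -/
def Wp (O : ℕ → ℕ → ℕ) (ω : ℕ → Bool) (p : Prog) (T : ℕ) (Q : State → Prop) (σ : State) : Prop :=
  ∃ t ≤ T, ∃ σ', Q σ' ∧ ∀ K, (step O ω)^[t] (p :: K, σ) = (K, σ')

section Wp

variable {O : ℕ → ℕ → ℕ} {ω : ℕ → Bool} {p q : Prog} {T T' : ℕ} {Q Q' : State → Prop} {σ : State}

theorem Wp.mono (h : Wp O ω p T Q σ) (hT : T ≤ T') (hQ : ∀ σ', Q σ' → Q' σ') :
    Wp O ω p T' Q' σ := by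
  obtain ⟨t, ht, σ', hσ', hr⟩ := h
  exact ⟨t, ht.trans hT, σ', hQ _ hσ', hr⟩

theorem Wp.const {d c : ℕ} (h : Q (σ.set d c)) : Wp O ω (.const d c) 1 Q σ :=
  ⟨1, le_rfl, _, h, fun _ => rfl⟩

theorem Wp.add {d x y : ℕ} (h : Q (σ.set d (σ.reg x + σ.reg y))) : Wp O ω (.add d x y) 1 Q σ :=
  ⟨1, le_rfl, _, h, fun _ => rfl⟩

theorem Wp.sub {d x y : ℕ} (h : Q (σ.set d (σ.reg x - σ.reg y))) : Wp O ω (.sub d x y) 1 Q σ :=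
  ⟨1, le_rfl, _, h, fun _ => rfl⟩

theorem Wp.hash {d j x : ℕ} (h : Q (σ.set d (O (σ.reg j) (σ.reg x)))) :
    Wp O ω (.hash d j x) 1 Q σ :=
  ⟨1, le_rfl, _, h, fun _ => rfl⟩

theorem Wp.emit {x v : ℕ} (h : Q { σ with out := σ.out ++ [(σ.reg x, σ.reg v)] }) :
    Wp O ω (.emit x v) 1 Q σ :=
  ⟨1, le_rfl, _, h, fun _ => rfl⟩

/-- `Wp` quantifies over the rest `K` of the stack, so the run of `p` applies with `q :: K` below
it. The extra step unpacks the sequence. -/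
theorem Wp.seq (h : Wp O ω p T (Wp O ω q T' Q) σ) : Wp O ω (.seq p q) (T + T' + 1) Q σ := by
  obtain ⟨t, ht, σ', ⟨t', ht', σ'', hQ, hr'⟩, hr⟩ := h
  refine ⟨t' + t + 1, by omega, σ'', hQ, fun K => ?_⟩
  rw [Function.iterate_add_apply, Function.iterate_add_apply]
  change (step O ω)^[t'] ((step O ω)^[t] (p :: q :: K, σ)) = _
  rw [hr, hr']

theorem Wp.ite {x : ℕ} (hp : σ.reg x ≠ 0 → Wp O ω p T Q σ) (hq : σ.reg x = 0 → Wp O ω q T Q σ) :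
    Wp O ω (.ite x p q) (T + 1) Q σ := by
  by_cases hx : σ.reg x = 0
  · obtain ⟨t, ht, σ', hQ, hr⟩ := hq hx
    refine ⟨t + 1, by omega, σ', hQ, fun K => ?_⟩
    rw [Function.iterate_succ_apply, ← hr K]
    simp [step, hx]
  · obtain ⟨t, ht, σ', hQ, hr⟩ := hp hx
    refine ⟨t + 1, by omega, σ', hQ, fun K => ?_⟩
    rw [Function.iterate_succ_apply, ← hr K]
    simp [step, hx]

/-- A loop with an invariant that counts the remaining rounds. -/
theorem Wp.while {x : ℕ} {I : ℕ → State → Prop} (h0 : ∀ σ, I 0 σ → σ.reg x = 0)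
    (hs : ∀ c σ, I (c + 1) σ → σ.reg x ≠ 0 ∧ Wp O ω p T (I c) σ) :
    ∀ (c : ℕ) (σ : State), I c σ → Wp O ω (.while x p) (c * (T + 1) + 1) (I 0) σ := by
  intro c
  induction c with
  | zero =>
    intro σ hσ
    refine ⟨1, by omega, σ, hσ, fun K => ?_⟩
    simp [step, h0 σ hσ]
  | succ c ih =>
    intro σ hσ
    obtain ⟨hx, t, ht, σ', hI, hr⟩ := hs c σ hσ
    obtain ⟨t', ht', σ'', hQ, hr'⟩ := ih σ' hI
    refine ⟨t' + t + 1, by linarith, σ'', hQ, fun K => ?_⟩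
    rw [Function.iterate_add_apply, Function.iterate_add_apply]
    have : (step O ω)^[1] (Prog.while x p :: K, σ) = (p :: .while x p :: K, σ) := by
      simp [step, hx]
    rw [this, hr, hr']

end Wp

@[simp] theorem State.set_reg (σ : State) (d v r : ℕ) :
    (σ.set d v).reg r = if r = d then v else σ.reg r := by
  simp [State.set, Function.update_apply]

@[simp] theorem State.set_out (σ : State) (d v : ℕ) : (σ.set d v).out = σ.out := rfl

theorem iterate_step_nil (O : ℕ → ℕ → ℕ) (ω : ℕ → Bool) (σ : State) (t : ℕ) :
    (step O ω)^[t] ([], σ) = ([], σ) :=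
  Function.iterate_fixed rfl t

/-! ### The adversary

Registers: 0 to 3 hold `lam`, the number of items still to be emitted, `k` and `b`; 6 holds `1`,
7 the next identifier, 10 the threshold, 15 holds `0`. -/

/-- Adds the product of `r 8` and `r y` to `r acc`. -/
def mulProg (acc y : ℕ) : Prog := .while 8 (.seq (.add acc acc y) (.sub 8 8 6))

/-- `r 10 := max 1 (b / (a * k))` -/
def thresholdProg (a : ℕ) : Prog :=
  .seq (.const 6 1) <| .seq (.const 8 a) <| .seq (mulProg 11 2) <|
  .seq (.add 8 3 6) <| .seq (.sub 8 8 11) <|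
  .seq (.while 8 (.seq (.add 10 10 6) (.sub 8 8 11))) <|
  .seq (.sub 8 6 10) (.add 10 10 8)

/-- `r 7 := lam ^ d` -/
def powProg : ℕ → Prog
  | 0 => .const 7 1
  | d + 1 => .seq (powProg d) <| .seq (.const 9 0) <| .seq (.add 8 0 15) <|
      .seq (mulProg 9 7) (.add 7 9 15)

/-- Makes `r 12` positive if some hash value of the identifier `r 7` reaches the threshold. -/
def testProg : Prog :=
  .seq (.const 12 0) <| .seq (.add 13 2 15) <| .while 13 <|
    .seq (.sub 13 13 6) <| .seq (.hash 14 13 7) <| .seq (.add 14 14 6) <|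
    .seq (.sub 14 14 10) (.add 12 12 14)

/-- Emits the first `n` identifiers below `r 7`, in descending order, all hash values of which are
below the threshold. -/
def scanProg : Prog :=
  .while 7 <| .seq (.sub 7 7 6) <| .seq testProg <|
    .ite 12 (.const 12 0) (.ite 1 (.seq (.emit 7 15) (.sub 1 1 6)) (.const 12 0))

/-- The adversary that tries the first `lam ^ d` identifiers and outputs `n` items that are hashed
to the first `max 1 (b / (a * k))` entries of each sub-table. -/
def attack (a d : ℕ) : Prog := .seq (thresholdProg a) (.seq (powProg d) scanProg)

/-! ### Output and running time of the attack program -/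

section Spec

variable (O : ℕ → ℕ → ℕ) (ω : ℕ → Bool)

/-- With c rounds left, `r acc + c * r y` is invariant; the register conditions keep the summand `r
y` and the constant `r 6` untouched. -/
theorem wp_mulProg {acc y : ℕ} (h8 : acc ≠ 8) (h6 : acc ≠ 6) (hy : y ≠ acc) (hy8 : y ≠ 8)
    (σ : State) (hone : σ.reg 6 = 1) :
    Wp O ω (mulProg acc y) (σ.reg 8 * 4 + 1) (fun σ' =>
      σ'.reg acc = σ.reg acc + σ.reg 8 * σ.reg y ∧
      (∀ r, r ≠ acc → r ≠ 8 → σ'.reg r = σ.reg r) ∧ σ'.out = σ.out) σ := by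
  have key := Wp.while (O := O) (ω := ω) (x := 8) (T := 3)
    (p := .seq (.add acc acc y) (.sub 8 8 6))
    (I := fun c σ' => σ'.reg 8 = c ∧ σ'.reg acc + c * σ.reg y = σ.reg acc + σ.reg 8 * σ.reg y ∧
      (∀ r, r ≠ acc → r ≠ 8 → σ'.reg r = σ.reg r) ∧ σ'.out = σ.out)
    (fun σ' h => h.1) ?_ (σ.reg 8) σ ⟨rfl, rfl, fun _ _ _ => rfl, rfl⟩
  · exact key.mono le_rfl fun σ' h => ⟨by simpa using h.2.1, h.2.2⟩
  · rintro c σ' ⟨hc, hacc, hfr, hout⟩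
    refine ⟨by omega, .seq (.add (.sub ?_))⟩
    have e6 := hfr 6 (Ne.symm h6) (by decide)
    have ey := hfr y hy hy8
    refine ⟨?_, ?_, ?_, by simpa using hout⟩
    · simp [h8.symm, h6.symm, hc, e6, hone]
    · simp [h8, ey, ← hacc]; ring
    · intro r h h'
      simp [h, h', hfr]

theorem wp_thresholdProg (a : ℕ) (σ : State) (ha : 0 < a) (hk : 0 < σ.reg 2) (h10 : σ.reg 10 = 0)
    (h11 : σ.reg 11 = 0) :
    Wp O ω (thresholdProg a) (4 * a + 4 * σ.reg 3 + 20) (fun σ' =>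
      σ'.reg 10 = max 1 (σ.reg 3 / (a * σ.reg 2)) ∧ σ'.reg 6 = 1 ∧
      (∀ r, r ≠ 6 → r ≠ 8 → r ≠ 10 → r ≠ 11 → σ'.reg r = σ.reg r) ∧ σ'.out = σ.out) σ := by
  set q := a * σ.reg 2 with hq
  have hq0 : 0 < q := Nat.mul_pos ha hk
  set b := σ.reg 3 with hb
  -- Division by repeated subtraction. After m rounds `r 8` is b + 1 - (m + 1) q, which under
  -- truncation is nonzero exactly when another q fits into b; hence the initial + 1.
  have hloop : ∀ σ₁ : State, σ₁.reg 6 = 1 → σ₁.reg 10 = 0 → σ₁.reg 11 = q → σ₁.reg 8 = b + 1 - q →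
      Wp O ω (.while 8 (.seq (.add 10 10 6) (.sub 8 8 11))) (b / q * (3 + 1) + 1) (fun σ' =>
        σ'.reg 10 = b / q ∧ (∀ r, r ≠ 8 → r ≠ 10 → σ'.reg r = σ₁.reg r) ∧ σ'.out = σ₁.out) σ₁ := by
    intro σ₁ h6 h10 h11 h8
    have key := Wp.while (O := O) (ω := ω) (x := 8) (T := 3)
      (p := .seq (.add 10 10 6) (.sub 8 8 11))
      (I := fun c σ' => σ'.reg 10 + c = b / q ∧ σ'.reg 8 = b + 1 - (σ'.reg 10 + 1) * q ∧
        (∀ r, r ≠ 8 → r ≠ 10 → σ'.reg r = σ₁.reg r) ∧ σ'.out = σ₁.out)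
      ?_ ?_ (b / q) σ₁ ⟨by simp [h10], by simp [h10, h8], fun _ _ _ => rfl, rfl⟩
    · exact key.mono le_rfl fun σ' h => ⟨by simpa using h.1, h.2.2⟩
    · rintro σ' ⟨h, h', -⟩
      rw [h', show σ'.reg 10 = b / q by simpa using h]
      have := Nat.lt_mul_div_succ b hq0
      rw [Nat.sub_eq_zero_iff_le]
      linarith
    · rintro c σ' ⟨h, h', hfr, hout⟩
      have hle : (σ'.reg 10 + 1) * q ≤ b :=
        (Nat.mul_le_mul_right q (by omega)).trans (Nat.div_mul_le_self b q)
      refine ⟨by omega, .seq (.add (.sub ?_))⟩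
      have e6 := hfr 6 (by decide) (by decide)
      have e11 := hfr 11 (by decide) (by decide)
      refine ⟨by simp [e6, h6]; omega, ?_, ?_, by simpa using hout⟩
      · simp only [State.set_reg, e6, e11, h6, h11, h']
        simp
        rw [Nat.sub_sub]
        congr 1
        ring
      · intro r hr hr'
        simp [hr, hr', hfr]
  have hdiv : b / q ≤ b := Nat.div_le_self b q
  refine (Wp.seq (.const (.seq (.const (.seq ((wp_mulProg O ω (by decide) (by decide) (by decide)
    (by decide) _ ?_).mono (T' := 4 * a + 1) ?_ ?_)))))).mono (T := 1 + (1 + (4 * a + 1 + (1 + (1 +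
      (b / q * (3 + 1) + 1 + (1 + 1 + 1) + 1) + 1) + 1) + 1) + 1) + 1) (by omega) (fun _ h => h)
  · simp
  · simp; omega
  rintro σ₁ ⟨h11', hfr, hout⟩
  simp [h11, ← hq] at h11'
  have e6 : σ₁.reg 6 = 1 := by simp [hfr]
  have e3 : σ₁.reg 3 = b := by simp [hfr, hb]
  refine .seq (.add (.seq (.sub (.seq (T := b / q * (3 + 1) + 1) (T' := 1 + 1 + 1) ((hloop _ ?_ ?_ ?_ ?_).mono le_rfl ?_)))))
  · simp [e6]
  · simp [hfr, h10]
  · simp [h11']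
  · simp [h11', e3, e6]
  rintro σ₂ ⟨h10', hfr', hout'⟩
  have e6' : σ₂.reg 6 = 1 := by simp [hfr', e6]
  -- The truncated difference `1 - r 10` is 1 only if the quotient is 0, so adding it produces the
  -- maximum with 1.
  refine .seq (.sub (.add ⟨?_, ?_, ?_, ?_⟩))
  · simp [h10', e6']; omega
  · simp [e6']
  · intro r h6 h8 h10 h11
    simp [*]
  · simp [*]

/-- The loop counter of each multiplication is `r 0` and the summand is the previous power, so the
time is linear in `r 0` although the result is a d-th power. Adding `r 15 = 0` copies a register. -/
theorem wp_powProg (d : ℕ) (σ : State) (h6 : σ.reg 6 = 1) (h15 : σ.reg 15 = 0) :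
    Wp O ω (powProg d) (d * (4 * σ.reg 0 + 8) + 1) (fun σ' =>
      σ'.reg 7 = σ.reg 0 ^ d ∧
      (∀ r, r ≠ 7 → r ≠ 8 → r ≠ 9 → σ'.reg r = σ.reg r) ∧ σ'.out = σ.out) σ := by
  induction d with
  | zero =>
    refine (Wp.const ⟨by simp, fun r h _ _ => by simp [h], rfl⟩).mono (by omega) (fun _ h => h)
  | succ d ih =>
    refine (Wp.seq (ih.mono le_rfl ?_)
      (T' := 1 + (1 + (4 * σ.reg 0 + 1 + 1 + 1) + 1) + 1)).mono ?_ (fun _ h => h)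
    on_goal 2 => rw [add_one_mul (d : ℕ)]; omega
    rintro σ₁ ⟨h7, hfr, hout⟩
    have e0 : σ₁.reg 0 = σ.reg 0 := by simp [hfr]
    have e6 : σ₁.reg 6 = 1 := by simp [hfr, h6]
    have e15 : σ₁.reg 15 = 0 := by simp [hfr, h15]
    refine .seq (.const (.seq (.add (.seq (T := 4 * σ.reg 0 + 1) (T' := 1) ((wp_mulProg O ω (by decide) (by decide) (by decide)
      (by decide) _ (by simp [e6])).mono ?_ ?_)))))
    · simp [e0, e15]; omega
    rintro σ₂ ⟨h9, hfr', hout'⟩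
    refine .add ⟨?_, ?_, ?_⟩
    · simp [h9, hfr', e0, e15, h7, pow_succ']
    · intro r h7 h8 h9
      simp [*]
    · simp [*]

/-- The truncated value O + 1 - t is zero exactly when O < t, and a sum of naturals vanishes only if
every term does. -/
theorem wp_testProg (σ : State) (h6 : σ.reg 6 = 1) (h15 : σ.reg 15 = 0) :
    Wp O ω testProg (σ.reg 2 * 10 + 5) (fun σ' =>
      (σ'.reg 12 = 0 ↔ ∀ j < σ.reg 2, O j (σ.reg 7) < σ.reg 10) ∧
      (∀ r, r ≠ 12 → r ≠ 13 → r ≠ 14 → σ'.reg r = σ.reg r) ∧ σ'.out = σ.out) σ := by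
  refine (Wp.seq (.const (.seq (.add ((Wp.while (T := 9) (I := fun c σ' => c ≤ σ.reg 2 ∧ σ'.reg 13 = c ∧
      (σ'.reg 12 = 0 ↔ ∀ j < σ.reg 2, c ≤ j → O j (σ.reg 7) < σ.reg 10) ∧
      (∀ r, r ≠ 12 → r ≠ 13 → r ≠ 14 → σ'.reg r = σ.reg r) ∧ σ'.out = σ.out)
      ?_ ?_ (σ.reg 2) _ ?_).mono le_rfl ?_))))).mono (by omega) (fun _ h => h)
  · exact fun σ' h => h.2.1
  · rintro c σ' ⟨hc, h13, h12, hfr, hout⟩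
    refine ⟨by omega, .seq (.sub (.seq (.hash (.seq (.add (.seq (.sub (.add ?_))))))))⟩
    have e6 := (hfr 6 (by decide) (by decide) (by decide)).trans h6
    have e7 := hfr 7 (by decide) (by decide) (by decide)
    have e10 := hfr 10 (by decide) (by decide) (by decide)
    refine ⟨by omega, by simp [h13, e6], ?_, ?_, by simpa using hout⟩
    · simp [h13, e6, e7, e10, h12]
      constructor
      · rintro ⟨h, h'⟩ j hj hcj
        rcases hcj.eq_or_lt with rfl | hlt
        · omega
        · exact h j hj hlt
      · exact fun h => ⟨fun j hj hcj => h j hj (by omega), by have := h c hc le_rfl; omega⟩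
    · intro r h12 h13 h14
      simp [*]
  · refine ⟨le_rfl, by simp [h15], ?_, ?_, by simp⟩
    · simp; intro j hj hj'; omega
    · intro r h12 h13 h14
      simp [*]
  · rintro σ' ⟨-, -, h, h'⟩
    exact ⟨by simpa using h, h'⟩

/-- The specification of the list of identifiers that are emitted when those of `S` are tried. -/
structure IsScan (n k t : ℕ) (S : Finset ℕ) (L : List ℕ) : Prop where
  nodup : L.Nodup
  mem : ∀ x ∈ L, x ∈ S ∧ ∀ j < k, O j x < t
  length : L.length = min n (S.filter fun x => ∀ j < k, O j x < t).card

theorem wp_scanProg (σ : State) (h6 : σ.reg 6 = 1) (h15 : σ.reg 15 = 0) :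
    Wp O ω scanProg (σ.reg 7 * (σ.reg 2 * 10 + 20) + 1) (fun σ' =>
      ∃ L, σ'.out = σ.out ++ L.map (·, 0) ∧
        IsScan O (σ.reg 1) (σ.reg 2) (σ.reg 10) (Finset.range (σ.reg 7)) L) σ := by
  set n := σ.reg 1
  set k := σ.reg 2
  set N := σ.reg 7
  set t := σ.reg 10
  -- `r 1` counts the items still wanted, so `r 1 + L.length = n`. Once it is 0, further good
  -- identifiers are skipped and the minimum in `IsScan` stays n. The assignments to `r 12` in the
  -- idle branches only fill the syntax.
  refine (Wp.while (T := σ.reg 2 * 10 + 19) (I := fun c σ' => c ≤ N ∧ σ'.reg 7 = c ∧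
    σ'.reg 2 = k ∧ σ'.reg 6 = 1 ∧ σ'.reg 10 = t ∧ σ'.reg 15 = 0 ∧
    ∃ L, σ'.out = σ.out ++ L.map (·, 0) ∧ σ'.reg 1 + L.length = n ∧
      IsScan O n k t (Finset.Ico c N) L) ?_ ?_ N σ ?_).mono le_rfl ?_
  · exact fun σ' h => h.2.1
  · rintro c σ' ⟨hc, h7, h2, h6, h10, h15, L, hout, h1, hL⟩
    refine ⟨by omega, (Wp.seq (.sub (.seq (T := σ.reg 2 * 10 + 5) (T' := 5 + 1)
      ((wp_testProg O ω _ ?_ ?_).mono ?_ ?_)))).mono (by omega) (fun _ h => h)⟩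
    · simp [h6]
    · simp [h15]
    · simp [h2, k]
    rintro σ₁ ⟨htest, hfr, hout₁⟩
    simp [h2, h6, h7, h10] at htest
    have e1 : σ₁.reg 1 = σ'.reg 1 := by simp [hfr]
    have e2 : σ₁.reg 2 = k := by simp [hfr, h2]
    have e6 : σ₁.reg 6 = 1 := by simp [hfr, h6]
    have e7 : σ₁.reg 7 = c := by simp [hfr, h6, h7]
    have e10 : σ₁.reg 10 = t := by simp [hfr, h10]
    have e15 : σ₁.reg 15 = 0 := by simp [hfr, h15]
    have hIco : Finset.Ico c N = insert c (Finset.Ico (c + 1) N) :=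
      (Finset.insert_Ico_add_one_left_eq_Ico hc).symm
    refine .ite (fun h12 => Wp.mono (.const ?_) (by omega : 1 ≤ 4 + 1) (fun _ h => h))
      fun h12 => .ite (T := 4) (fun hr1 => Wp.mono (.seq (.emit (.sub ?_))) (by omega) (fun _ h => h))
        fun hr1 => Wp.mono (.const ?_) (by omega : 1 ≤ 4) (fun _ h => h)
    · refine ⟨by omega, by simp [e7], by simp [e2], by simp [e6], by simp [e10], by simp [e15],
        L, by simp [hout₁, hout], by simp [e1, h1], hL.nodup, fun x hx => ?_, ?_⟩
      · have := hL.mem x hx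
        exact ⟨by rw [hIco]; exact Finset.mem_insert_of_mem this.1, this.2⟩
      · rw [hL.length, hIco, Finset.filter_insert, if_neg (by rwa [← htest])]
    · have hgood := htest.1 h12
      have hcL : c ∉ L := fun h => by simpa using (hL.mem c h).1
      have hlen := hL.length
      refine ⟨by omega, by simp [e7], by simp [e2], by simp [e6], by simp [e10], by simp [e15],
        L ++ [c], by simp [hout₁, hout, e7, e15], by simp [e1, e6]; omega, ?_, fun x hx => ?_, ?_⟩
      · rw [List.nodup_append_comm]
        simpa [hL.nodup] using hcL
      · rw [List.mem_append, List.mem_singleton] at hx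
        rcases hx with hx | rfl
        · have := hL.mem x hx
          exact ⟨by rw [hIco]; exact Finset.mem_insert_of_mem this.1, this.2⟩
        · exact ⟨by rw [hIco]; exact Finset.mem_insert_self _ _, hgood⟩
      · rw [hIco, Finset.filter_insert, if_pos hgood, Finset.card_insert_of_notMem (by simp)]
        simp only [List.length_append, List.length_singleton]
        omega
    · have hgood := htest.1 h12
      have hlen := hL.length
      refine ⟨by omega, by simp [e7], by simp [e2], by simp [e6], by simp [e10], by simp [e15],
        L, by simp [hout₁, hout], by simp [e1, h1], hL.nodup, fun x hx => ?_, ?_⟩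
      · have := hL.mem x hx
        exact ⟨by rw [hIco]; exact Finset.mem_insert_of_mem this.1, this.2⟩
      · rw [hIco, Finset.filter_insert, if_pos hgood, Finset.card_insert_of_notMem (by simp)]
        omega
  · exact ⟨le_rfl, rfl, rfl, h6, rfl, h15, [], by simp, by simp [n], by simp, by simp, by simp⟩
  · rintro σ' ⟨-, -, -, -, -, -, L, hout, -, hL⟩
    exact ⟨L, hout, by rwa [← Finset.range_eq_Ico] at hL⟩

theorem wp_attack (a d : ℕ) (ha : 0 < a) (P : Params) :
    Wp O ω (attack a d)
      (4 * a + 4 * P.b + 20 + (d * (4 * P.lam + 8) + 1 + (P.lam ^ d * (P.k * 10 + 20) + 1) + 1) + 1)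
      (fun σ' => ∃ L, σ'.out = L.map (·, 0) ∧
        IsScan O P.n P.k (max 1 (P.b / (a * P.k))) (Finset.range (P.lam ^ d)) L) P.initState := by
  refine .seq ((wp_thresholdProg O ω a P.initState ha P.one_le_k rfl rfl).mono le_rfl ?_)
  rintro σ₁ ⟨h10, h6, hfr, hout⟩
  have e0 : σ₁.reg 0 = P.lam := hfr 0 (by decide) (by decide) (by decide) (by decide)
  have e1 : σ₁.reg 1 = P.n := hfr 1 (by decide) (by decide) (by decide) (by decide)
  have e2 : σ₁.reg 2 = P.k := hfr 2 (by decide) (by decide) (by decide) (by decide)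
  have e15 : σ₁.reg 15 = 0 := hfr 15 (by decide) (by decide) (by decide) (by decide)
  refine .seq ((wp_powProg O ω d σ₁ h6 e15).mono (by rw [e0]) ?_)
  rintro σ₂ ⟨h7, hfr', hout'⟩
  have f1 : σ₂.reg 1 = P.n := by simp [hfr', e1]
  have f2 : σ₂.reg 2 = P.k := by simp [hfr', e2]
  have f10 : σ₂.reg 10 = max 1 (P.b / (a * P.k)) := by
    rw [hfr' 10 (by decide) (by decide) (by decide), h10]; rfl
  refine (wp_scanProg O ω σ₂ (by simp [hfr', h6]) (by simp [hfr', e15])).mono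
    (by rw [h7, e0, f2]) ?_
  rintro σ₃ ⟨L, hL, hscan⟩
  rw [f1, f2, f10, h7, e0] at hscan
  exact ⟨L, by rw [hL, hout', hout]; rfl, hscan⟩

end Spec

/-! ### Probability -/

theorem covariance_indicator_one {Ω : Type*} [MeasurableSpace Ω] (μ : Measure Ω)
    [IsProbabilityMeasure μ] {s t : Set Ω} (hs : MeasurableSet s) (ht : MeasurableSet t) :
    ProbabilityTheory.covariance (s.indicator 1) (t.indicator 1) μ =
      μ.real (s ∩ t) - μ.real s * μ.real t := by
  have hL : ∀ u : Set Ω, MeasurableSet u → MemLp (u.indicator (1 : Ω → ℝ)) 2 μ := fun u hu =>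
    (memLp_const (1 : ℝ)).indicator hu
  rw [ProbabilityTheory.covariance_eq_sub (hL s hs) (hL t ht), integral_indicator_one hs,
    integral_indicator_one ht, ← Set.inter_indicator_one, integral_indicator_one (hs.inter ht)]

/-- A second moment bound: it is unlikely that much fewer than the expected number of pairwise
independent events happen. -/
theorem measure_card_lt_le {Ω ι : Type*} [MeasurableSpace Ω] (μ : Measure Ω)
    [IsProbabilityMeasure μ] (S : Finset ι) (G : ι → Set Ω) (hG : ∀ i ∈ S, MeasurableSet (G i))
    {p : ℝ} (hp : ∀ i ∈ S, μ.real (G i) = p)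
    (hpair : ∀ i ∈ S, ∀ j ∈ S, i ≠ j → μ.real (G i ∩ G j) = p * p) {r : ℝ} (hr : r < S.card * p) :
    μ {ω | ∑ i ∈ S, (G i).indicator (1 : Ω → ℝ) ω ≤ r} ≤
      ENNReal.ofReal (S.card * p / (S.card * p - r) ^ 2) := by
  have hL : ∀ i ∈ S, MemLp ((G i).indicator (1 : Ω → ℝ)) 2 μ := fun i hi =>
    (memLp_const (1 : ℝ)).indicator (hG i hi)
  set X : Ω → ℝ := ∑ i ∈ S, (G i).indicator (1 : Ω → ℝ) with hX
  have hXL : MemLp X 2 μ := memLp_finsetSum' S hL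
  have hE : ∫ ω, X ω ∂μ = S.card * p := by
    have : ∀ ω, X ω = ∑ i ∈ S, (G i).indicator (1 : Ω → ℝ) ω := fun ω => by
      rw [hX, Finset.sum_apply]
    simp_rw [this]
    rw [integral_finsetSum S fun i hi => (hL i hi).integrable (by norm_num),
      Finset.sum_congr rfl fun i hi => (integral_indicator_one (hG i hi)).trans (hp i hi)]
    simp
  have hV : ProbabilityTheory.variance X μ ≤ S.card * p := by
    rw [hX, ProbabilityTheory.variance_sum' hL]
    calc _ ≤ ∑ i ∈ S, p := Finset.sum_le_sum fun i hi => ?_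
      _ = _ := by simp
    -- Pairwise independence kills the off-diagonal covariances; each diagonal term is p - p², at
    -- most p.
    rw [Finset.sum_eq_single_of_mem i hi fun j hj hij => by
      rw [covariance_indicator_one μ (hG i hi) (hG j hj), hpair i hi j hj hij.symm, hp i hi, hp j hj,
        sub_self], covariance_indicator_one μ (hG i hi) (hG i hi), Set.inter_self, hp i hi]
    nlinarith [mul_self_nonneg p]
  have hpos : 0 < S.card * p - r := by linarith
  calc _ ≤ μ {ω | S.card * p - r ≤ |X ω - ∫ ω, X ω ∂μ|} := by
        refine measure_mono fun ω hω => ?_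
        rw [Set.mem_ofPred_eq, hE, abs_sub_comm, hX, Finset.sum_apply]
        exact le_trans (sub_le_sub_left hω _) (le_abs_self _)
    _ ≤ _ := ProbabilityTheory.meas_ge_le_variance_div_sq hXL hpos
    _ ≤ _ := ENNReal.ofReal_le_ofReal (by gcongr)

/-! ### Distribution of the number of confined identifiers -/

namespace Params

variable {P : Params}

instance : IsProbabilityMeasure P.hashMeasure := by
  unfold hashMeasure; infer_instance

/-- All hash values of the identifiers in `S` are less than `t`. -/
def allBelow (t : ℕ) (S : Finset P.Id) : Set P.HashFns :=
  {H | ∀ x ∈ S, ∀ j, (H (x, j)).val < t}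

theorem allBelow_eq_pi (t : ℕ) (S : Finset P.Id) :
    allBelow t S = Set.pi ((S ×ˢ Finset.univ : Finset (P.Id × Fin P.k)) : Set (P.Id × Fin P.k))
      fun _ => {e : Fin P.subSize | e.val < t} := by
  ext H
  simp only [allBelow, Set.mem_ofPred_eq, Set.mem_pi, Finset.mem_coe, Finset.mem_product,
    Finset.mem_univ, and_true, Prod.forall]
  exact ⟨fun h x j hx => h x hx j, fun h x hx j => h x j hx⟩

theorem measurableSet_allBelow (t : ℕ) (S : Finset P.Id) : MeasurableSet (allBelow t S) := by
  rw [allBelow_eq_pi]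
  exact MeasurableSet.pi (Finset.countable_toSet _) fun _ _ => MeasurableSet.of_discrete

/-- Sets of one and of two identifiers supply the marginal and the pairwise probabilities for the
second moment bound. -/
theorem hashMeasure_allBelow {t : ℕ} (ht : t ≤ P.subSize) (S : Finset P.Id) :
    P.hashMeasure.real (allBelow t S) = ((t / P.subSize : ℝ) ^ P.k) ^ S.card := by
  have h1 : (PMF.uniformOfFintype (Fin P.subSize)).toMeasure {e : Fin P.subSize | e.val < t} =
      (t / P.subSize : ℝ≥0∞) := by
    classical
    rw [PMF.toMeasure_uniformOfFintype_apply _ MeasurableSet.of_discrete, Fintype.card_fin,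
      Fintype.card_subtype]
    congr 2
    simpa [ht] using Fin.card_filter_val_lt (n := P.subSize) (m := t)
  rw [measureReal_def, hashMeasure, allBelow_eq_pi,
    Measure.infinitePi_pi _ fun _ _ => MeasurableSet.of_discrete, Finset.prod_congr rfl fun _ _ => h1]
  simp [ENNReal.toReal_div, pow_mul, mul_comm]

theorem forall_oracle_lt_iff {t x : ℕ} (hx : (x : ℕ∞) < P.idBound) (H : P.HashFns) :
    (∀ j < P.k, oracle H j x < t) ↔ ∀ j, (H (⟨x, hx⟩, j)).val < t := by
  constructor
  · intro h j
    simpa [oracle, hx] using h j j.2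
  · intro h j hj
    simpa [oracle, hx, hj] using h ⟨j, hj⟩

/-- It is unlikely that much fewer identifiers than expected have only hash values below `t`. -/
theorem hashMeasure_card_lt_le {t N : ℕ} (ht : t ≤ P.subSize) (hN : (N : ℕ∞) ≤ P.idBound)
    {n : ℕ} (hn : (n : ℝ) < N * (t / P.subSize : ℝ) ^ P.k) :
    P.hashMeasure {H | ((Finset.range N).filter fun x => ∀ j < P.k, oracle H j x < t).card < n} ≤
      ENNReal.ofReal (N * (t / P.subSize : ℝ) ^ P.k /
        (N * (t / P.subSize : ℝ) ^ P.k - n) ^ 2) := by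
  classical
  have hid : ∀ {x}, x ∈ Finset.range N → (x : ℕ∞) < P.idBound := fun hx =>
    lt_of_lt_of_le (by exact_mod_cast Finset.mem_range.1 hx) hN
  set G : ℕ → Set P.HashFns := fun x => {H | ∀ j < P.k, oracle H j x < t} with hGdef
  have hG : ∀ x (hx : x ∈ Finset.range N), G x = allBelow t {⟨x, hid hx⟩} := fun x hx => by
    ext H
    simpa [allBelow, G] using forall_oracle_lt_iff (hid hx) H
  have key := measure_card_lt_le P.hashMeasure (Finset.range N) G
    (p := (t / P.subSize : ℝ) ^ P.k) (r := n) ?_ ?_ ?_ (by simpa using hn)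
  · rw [Finset.card_range] at key
    refine le_trans (measure_mono fun H hH => ?_) key
    have : ∑ x ∈ Finset.range N, (G x).indicator (1 : P.HashFns → ℝ) H =
        ((Finset.range N).filter fun x => ∀ j < P.k, oracle H j x < t).card := by
      rw [Finset.card_filter]
      push_cast
      exact Finset.sum_congr rfl fun x _ => by simp [Set.indicator_apply, G]
    rw [Set.mem_ofPred_eq, this]
    exact_mod_cast le_of_lt hH
  · intro x hx
    rw [hG x hx]
    exact measurableSet_allBelow _ _
  · intro x hx
    rw [hG x hx, hashMeasure_allBelow ht]
    simp
  · intro x hx y hy hxy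
    have : G x ∩ G y = allBelow t {⟨x, hid hx⟩, ⟨y, hid hy⟩} := by
      rw [hG x hx, hG y hy]
      ext H
      simp [allBelow]
    rw [this, hashMeasure_allBelow ht, Finset.card_pair (by simpa using hxy), sq]

end Params

/-! ### Success of the attack -/

namespace Params

variable {P : Params}

/-- Items that are hashed to the first `t` entries of each sub-table fill at most the cells of these
entries and the stash. -/
theorem Allocates.card_le {H : P.HashFns} {X : Finset P.Item} {T : P.Table} (h : Allocates H X T)
    {t : ℕ} (ht : ∀ x ∈ X, ∀ j, (H (x.1, j)).val < t) : X.card ≤ P.k * (t * P.ell) + P.s := by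
  classical
  choose f hf hT using h.1
  set F : Finset P.Loc := Finset.disjSum
    (Finset.univ ×ˢ ((Finset.univ.filter fun e : Fin P.subSize => e.val < t) ×ˢ Finset.univ))
    Finset.univ
  have hF : F.card ≤ P.k * (t * P.ell) + P.s := by
    simp only [F, Finset.card_disjSum, Finset.card_product, Finset.card_univ, Fintype.card_fin,
      Fin.card_filter_val_lt]
    gcongr
    exact min_le_right _ _
  rw [← Finset.card_attach]
  -- A cell holds at most one item, so sending each item to its cell is injective.
  refine (Finset.card_le_card_of_injOn (fun x : X => f x.1 x.2) ?_ ?_).trans hF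
  · rintro ⟨x, hx⟩ -
    have hfx := (Finset.mem_filter.1 (hf x hx)).2
    rcases hp : f x hx with ⟨j, e, c⟩ | p
    · have := ht x hx j
      rw [← hfx j e c hp] at this
      simp [F, hp, this]
    · simp [F, hp]
  · rintro ⟨x, hx⟩ - ⟨y, hy⟩ - hxy
    have := hT x hx
    rw [show f x hx = f y hy from hxy, hT y hy] at this
    exact Subtype.ext (Option.some.inj this).symm

theorem run_attack (a d : ℕ) (ha : 0 < a) (H : P.HashFns) (ω : ℕ → Bool) :
    ∃ t ≤ 4 * a + 4 * P.b + 20 +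
        (d * (4 * P.lam + 8) + 1 + (P.lam ^ d * (P.k * 10 + 20) + 1) + 1) + 1,
      HaltsWithin (attack a d) H ω t ∧ ∃ L, (run (attack a d) H ω t).2.out = L.map (·, 0) ∧
        IsScan (oracle H) P.n P.k (max 1 (P.b / (a * P.k))) (Finset.range (P.lam ^ d)) L := by
  obtain ⟨t, ht, σ, hσ, hr⟩ := wp_attack (oracle H) ω a d ha P
  refine ⟨t, ht, ?_⟩
  rw [HaltsWithin, run, hr]
  exact ⟨rfl, hσ⟩

theorem HaltsWithin.mono {A : Prog} {H : P.HashFns} {ω : ℕ → Bool} {t t' : ℕ}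
    (h : HaltsWithin A H ω t) (htt : t ≤ t') : HaltsWithin A H ω t' := by
  obtain ⟨u, rfl⟩ := Nat.exists_eq_add_of_le' htt
  rw [HaltsWithin, run, Function.iterate_add_apply]
  have : (step (oracle H) ω)^[t] ([A], P.initState) = ([], (run A H ω t).2) := Prod.ext h rfl
  rw [this, iterate_step_nil]

/-- The attack succeeds if the targeted entries and the stash cannot hold `n` items, and enough of
the tried identifiers are hashed there. -/
theorem mem_breakEvent (C : Construction P) {a d : ℕ} (ha : 0 < a)
    (hN : ((P.lam ^ d : ℕ) : ℕ∞) ≤ P.idBound)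
    (hcap : P.k * (max 1 (P.b / (a * P.k)) * P.ell) + P.s < P.n) {H : P.HashFns}
    (hH : P.n ≤ ((Finset.range (P.lam ^ d)).filter fun x =>
      ∀ j < P.k, oracle H j x < max 1 (P.b / (a * P.k))).card) (ω ω' : ℕ → Bool) :
    (H, ω, ω') ∈ breakEvent C (attack a d) := by
  classical
  obtain ⟨t, -, hhalt, L, hout, hL⟩ := run_attack (P := P) a d ha H ω
  have hid : ∀ x ∈ L, (x : ℕ∞) < P.idBound := fun x hx =>
    lt_of_lt_of_le (by exact_mod_cast Finset.mem_range.1 (hL.mem x hx).1) hN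
  let v0 : P.Val := ⟨0, lt_of_lt_of_le (by norm_num) P.one_le_valBound⟩
  let X : Finset P.Item := (L.toFinset.subtype fun x : ℕ => (x : ℕ∞) < P.idBound).map
    ⟨fun x => (x, v0), fun x y h => (Prod.ext_iff.1 h).1⟩
  have hmem : ∀ x : P.Item, x ∈ X ↔ x.1.val ∈ L ∧ x.2 = v0 := by
    rintro ⟨x, v⟩
    simp only [X, Finset.mem_map, Finset.mem_subtype, List.mem_toFinset]
    constructor
    · rintro ⟨y, hy, hyx⟩
      obtain ⟨rfl, rfl⟩ := Prod.ext_iff.1 hyx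
      exact ⟨hy, rfl⟩
    · rintro ⟨hx, rfl⟩
      exact ⟨x, hx, rfl⟩
  have hX : P.IsInput X := by
    constructor
    · rw [Finset.card_map, Finset.card_subtype, Finset.filter_true_of_mem fun x hx =>
        hid x (List.mem_toFinset.1 hx), List.toFinset_card_of_nodup hL.nodup, hL.length,
        min_eq_left hH]
    · intro x hx y hy hxy
      exact Prod.ext hxy (((hmem x).1 hx).2.trans ((hmem y).1 hy).2.symm)
  refine ⟨X, ⟨t, hhalt, fun q => ?_⟩, hX, ?_⟩
  · rw [hout, List.mem_map]
    constructor
    · rintro ⟨x, hx, rfl⟩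
      exact ⟨(⟨x, hid x hx⟩, v0), (hmem _).2 ⟨hx, rfl⟩, rfl⟩
    · rintro ⟨x, hx, rfl⟩
      exact ⟨x.1.val, ((hmem x).1 hx).1, by rw [((hmem x).1 hx).2]⟩
  -- A returned table would be a sound allocation of n items inside the target and the stash,
  -- contradicting `hcap`.
  · cases hT : C.construct H ω' X with
    | none => rfl
    | some T =>
      have := (C.sound H ω' X T hX hT).card_le (t := max 1 (P.b / (a * P.k))) fun x hx =>
        (forall_oracle_lt_iff x.1.2 H).1 (hL.mem _ ((hmem x).1 hx).1).2
      rw [hX.1] at this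
      omega

/-- Rounding down, with minimum value 1, costs at most a factor 2. Hence the target is at least a
1/(2a) fraction of each sub-table. -/
theorem le_mul_max_div (m : ℕ) {a : ℕ} (ha : 0 < a) : m ≤ 2 * a * max 1 (m / a) := by
  have h1 : m < a * (m / a + 1) := Nat.lt_mul_div_succ m ha
  have h2 : a * (m / a + 1) ≤ a * (2 * max 1 (m / a)) := Nat.mul_le_mul_left _ (by omega)
  linarith

/-- Since x ≥ 8l, the gap x - n is at least 7x/8, so the ratio is O(1/x) with x ≥ 16. This is the
Chebyshev bound for expectation x. -/
theorem div_sq_le_quarter {x l n : ℝ} (hl : 2 ≤ l) (hn : n ≤ l) (hx : l ^ 4 ≤ x) :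
    n < x ∧ x / (x - n) ^ 2 ≤ 1 / 4 := by
  have h3 : (2 : ℝ) ^ 3 ≤ l ^ 3 := pow_le_pow_left₀ (by norm_num) hl 3
  have h8 : 8 * l ≤ x := by nlinarith
  have hd : 7 / 8 * x ≤ x - n := by linarith
  refine ⟨by linarith, ?_⟩
  rw [div_le_iff₀ (pow_pos (by linarith) 2)]
  have : (7 / 8 * x) ^ 2 ≤ (x - n) ^ 2 := pow_le_pow_left₀ (by linarith) hd 2
  nlinarith

/-- The attack succeeds with probability more than one half. -/
theorem half_lt_gameMeasure (C : Construction P) {a e : ℕ} (ha : 0 < a) (hlam : 2 ≤ P.lam)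
    (hn : P.n ≤ P.lam) (hN : ((P.lam ^ (e + 4) : ℕ) : ℕ∞) ≤ P.idBound)
    (hk : (2 * a) ^ P.k ≤ P.lam ^ e)
    (hcap : P.k * (max 1 (P.b / (a * P.k)) * P.ell) + P.s < P.n) :
    1 / 2 < P.gameMeasure (breakEvent C (attack a (e + 4))) := by
  set t := max 1 (P.b / (a * P.k)) with ht
  -- Nested floors merge, so the threshold computed from b is also a fraction of the actual
  -- sub-table size ⌊b/k⌋.
  have htm : t = max 1 (P.subSize / a) := by
    rw [ht, subSize, Nat.div_div_eq_div_mul, mul_comm a]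
  have hsub := P.subSize_pos
  have ht_le : t ≤ P.subSize := by
    rw [htm]; exact max_le hsub (Nat.div_le_self _ _)
  have hm : P.subSize ≤ 2 * a * t := htm ▸ le_mul_max_div _ ha
  set x : ℝ := ((P.lam ^ (e + 4) : ℕ) : ℝ) * (t / P.subSize : ℝ) ^ P.k with hx
  have hsubR : (0 : ℝ) < P.subSize := by exact_mod_cast hsub
  have hlow : ((P.lam : ℝ)) ^ 4 ≤ x := by
    have h1 : 1 ≤ (2 * a : ℝ) * (t / P.subSize) := by
      rw [mul_div_assoc', le_div_iff₀ hsubR, one_mul]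
      exact_mod_cast hm
    have h2 : 1 ≤ (2 * a : ℝ) ^ P.k * (t / P.subSize : ℝ) ^ P.k := by
      rw [← mul_pow]; exact one_le_pow₀ h1
    have h3 : (2 * a : ℝ) ^ P.k ≤ (P.lam : ℝ) ^ e := by exact_mod_cast hk
    have h4 : 1 ≤ (P.lam : ℝ) ^ e * (t / P.subSize : ℝ) ^ P.k :=
      h2.trans (mul_le_mul_of_nonneg_right h3 (by positivity))
    calc (P.lam : ℝ) ^ 4 = P.lam ^ 4 * 1 := by ring
      _ ≤ P.lam ^ 4 * ((P.lam : ℝ) ^ e * (t / P.subSize : ℝ) ^ P.k) := by gcongr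
      _ = x := by rw [hx]; push_cast; ring
  obtain ⟨hnx, hq⟩ := div_sq_le_quarter (by exact_mod_cast hlam)
    (by exact_mod_cast hn : (P.n : ℝ) ≤ P.lam) hlow
  set B : Set P.HashFns := {H | ((Finset.range (P.lam ^ (e + 4))).filter fun x =>
    ∀ j < P.k, oracle H j x < t).card < P.n} with hB
  have hBle : P.hashMeasure B ≤ ENNReal.ofReal (1 / 4) :=
    (hashMeasure_card_lt_le ht_le hN hnx).trans (ENNReal.ofReal_le_ofReal hq)
  have hBc : 1 / 2 < P.hashMeasure Bᶜ := by
    -- Subadditivity suffices here, so `B` need not be shown measurable.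
    have h1 : 1 ≤ P.hashMeasure B + P.hashMeasure Bᶜ := by
      rw [← measure_univ (μ := P.hashMeasure), ← Set.union_compl_self B]
      exact measure_union_le _ _
    by_contra! h
    have h2 := h1.trans (add_le_add hBle h)
    rw [← ENNReal.ofReal_one, show ENNReal.ofReal 1 / 2 = ENNReal.ofReal (1 / 2) by
      rw [ENNReal.ofReal_div_of_pos] <;> norm_num, ← ENNReal.ofReal_add (by norm_num)
      (by norm_num), ENNReal.ofReal_le_ofReal_iff (by norm_num)] at h2
    norm_num at h2
  have : IsProbabilityMeasure coinMeasure := by unfold coinMeasure; infer_instance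
  calc 1 / 2 < P.hashMeasure Bᶜ := hBc
    _ = P.gameMeasure (Bᶜ ×ˢ Set.univ) := by
      rw [gameMeasure, Measure.prod_prod, measure_univ, mul_one]
    _ ≤ _ := measure_mono fun ⟨H, ω, ω'⟩ h =>
      mem_breakEvent C ha hN hcap (not_lt.1 (Set.mem_prod.1 h).1) ω ω'

end Params

/-! ### Polynomial running time and the main theorem -/

theorem isPolyTime_attack (P : ℕ → Params) {a : ℕ} (ha : 0 < a) (d : ℕ)
    (hlam : ∀ᶠ i in atTop, 2 ≤ (P i).lam) (hb : ∀ᶠ i in atTop, (P i).b ≤ a * (P i).lam) :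
    IsPolyTime P (attack a d) := by
  -- The scan costs about λ^d k, and k ≤ b ≤ aλ supplies the extra power of λ. The constant collects
  -- the coefficients of the explicit time bound.
  refine ⟨18 * a + 12 * d + 44, d + 1, ?_⟩
  filter_upwards [hlam, hb] with i hl hb H ω
  obtain ⟨t, ht, hhalt, -⟩ := Params.run_attack (P := P i) a d ha H ω
  refine hhalt.mono (ht.trans ?_)
  set l := (P i).lam
  have h1 : 1 ≤ l ^ (d + 1) := Nat.one_le_pow _ _ (by omega)
  have h2 : l ≤ l ^ (d + 1) := Nat.le_self_pow (by omega) l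
  have h3 : l ^ d ≤ l ^ (d + 1) := Nat.pow_le_pow_right (by omega) (by omega)
  have h4 : l ^ d * (P i).k ≤ a * l ^ (d + 1) := by
    calc l ^ d * (P i).k ≤ l ^ d * (a * l) := Nat.mul_le_mul_left _ ((P i).k_le_b.trans hb)
      _ = a * l ^ (d + 1) := by ring
  have h5 : a * l ≤ a * l ^ (d + 1) := Nat.mul_le_mul_left _ h2
  have h6 : a * 1 ≤ a * l ^ (d + 1) := Nat.mul_le_mul_left _ h1
  have h7 : d * l ≤ d * l ^ (d + 1) := Nat.mul_le_mul_left _ h2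
  have h8 : d * 1 ≤ d * l ^ (d + 1) := Nat.mul_le_mul_left _ h1
  linarith

end CuckooHashing

open CuckooHashing in
theorem mainTheorem8
    (P : ℕ → CuckooHashing.Params) (C : ∀ i, CuckooHashing.Construction (P i))
    (h_universe : ∀ d : ℕ, ∀ᶠ i in atTop, (((P i).lam ^ d : ℕ) : ℕ∞) ≤ (P i).idBound)
    (h_lam : ∀ i, (P i).n ≤ (P i).lam)
    (h_k : (fun i => ((P i).k : ℝ)) =O[atTop] fun i => Real.log ((P i).lam : ℝ))
    (h_b : (fun i => ((P i).b : ℝ)) =O[atTop] fun i => ((P i).n : ℝ) / ((P i).ell : ℝ))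
    (h_robust : CuckooHashing.Robust P C (1 / 2)) :
    ∃ c : ℝ, 0 < c ∧ ∀ᶠ i in atTop,
      ((P i).queryOverhead < (P i).n → c * (P i).n ≤ (P i).s + (P i).ell) ∧
      c * (P i).n ≤ (P i).queryOverhead := by
  obtain ⟨B, hBpos, hB⟩ := h_b.exists_pos
  obtain ⟨K, hKpos, hK⟩ := h_k.exists_pos
  rw [isBigOWith_iff] at hB hK
  -- The factor 2 leaves the targeted cells with room for at most n/2 items.
  obtain ⟨a, ha⟩ := exists_nat_ge (2 * B)
  have ha0 : 0 < a := by
    have : (0 : ℝ) < a := by linarith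
    exact_mod_cast this
  have hb : ∀ᶠ i in atTop, 2 * ((P i).b * (P i).ell) ≤ a * (P i).n := by
    filter_upwards [hB] with i hi
    have hl : (0 : ℝ) < (P i).ell := by exact_mod_cast (P i).one_le_ell
    rw [Real.norm_of_nonneg (by positivity), Real.norm_of_nonneg (by positivity), mul_div_assoc',
      le_div_iff₀ hl] at hi
    have : (2 : ℝ) * ((P i).b * (P i).ell) ≤ a * (P i).n := by
      nlinarith [mul_le_mul_of_nonneg_right ha (Nat.cast_nonneg (α := ℝ) (P i).n)]
    exact_mod_cast this
  -- For λ ≤ 1 the logarithm is 0 (`Real.log 0 = 0`), which would force k = 0.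
  have hlam : ∀ᶠ i in atTop, 2 ≤ (P i).lam := by
    filter_upwards [hK] with i hi
    by_contra! h
    have h0 : Real.log ((P i).lam : ℝ) = 0 := by
      rcases (by omega : (P i).lam = 0 ∨ (P i).lam = 1) with h | h <;> simp [h]
    have hk : (1 : ℝ) ≤ (P i).k := by exact_mod_cast (P i).one_le_k
    rw [h0, Real.norm_of_nonneg (by positivity), norm_zero, mul_zero] at hi
    linarith
  obtain ⟨e, he⟩ := exists_nat_ge (K * Real.log (2 * a))
  have hk : ∀ᶠ i in atTop, (2 * a) ^ (P i).k ≤ (P i).lam ^ e := by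
    filter_upwards [hK, hlam] with i hi hl
    have hl1 : (1 : ℝ) < (P i).lam := by exact_mod_cast hl
    have hlog := Real.log_pos hl1
    have ha1 : (1 : ℝ) ≤ 2 * a := by exact_mod_cast (by omega : 1 ≤ 2 * a)
    rw [Real.norm_of_nonneg (by positivity), Real.norm_of_nonneg hlog.le] at hi
    have : (2 * a : ℝ) ^ (P i).k ≤ ((P i).lam : ℝ) ^ e := by
      rw [← Real.log_le_log_iff (by positivity) (by positivity), Real.log_pow, Real.log_pow]
      calc ((P i).k : ℝ) * Real.log (2 * a) ≤ K * Real.log (P i).lam * Real.log (2 * a) :=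
            mul_le_mul_of_nonneg_right hi (Real.log_nonneg ha1)
        _ = K * Real.log (2 * a) * Real.log (P i).lam := by ring
        _ ≤ _ := mul_le_mul_of_nonneg_right he hlog.le
    exact_mod_cast this
  have hpoly : IsPolyTime P (attack a (e + 4)) := by
    refine isPolyTime_attack P ha0 _ hlam ?_
    filter_upwards [hb] with i hi
    have h1 := Nat.mul_le_mul_left (P i).b (P i).one_le_ell
    have h2 := Nat.mul_le_mul_left a (h_lam i)
    omega
  refine ⟨1 / 2, by norm_num, ?_⟩
  filter_upwards [h_robust _ hpoly, hb, hlam, hk, h_universe (e + 4)] with i hrob hb hlam hk hN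
  have key : (P i).queryOverhead < (P i).n → (P i).n ≤ 2 * (P i).s := by
    intro hq
    by_contra! hs
    refine absurd hrob (not_le.2 (Params.half_lt_gameMeasure (C i) ha0 hlam (h_lam i) hN hk ?_))
    -- If t = 1, the capacity is the query overhead itself; otherwise the target holds at most n/2
    -- items and the stash fewer than n/2.
    rcases le_total ((P i).b / (a * (P i).k)) 1 with h | h
    · rw [max_eq_left h, one_mul]
      exact hq
    · rw [max_eq_right h]
      have h1 : a * ((P i).k * ((P i).b / (a * (P i).k) * (P i).ell)) ≤ (P i).b * (P i).ell := by
        calc _ = (P i).b / (a * (P i).k) * (a * (P i).k) * (P i).ell := by ring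
          _ ≤ _ := Nat.mul_le_mul_right _ (Nat.div_mul_le_self _ _)
      have h2 : 2 * ((P i).k * ((P i).b / (a * (P i).k) * (P i).ell)) ≤ (P i).n :=
        Nat.le_of_mul_le_mul_left (by linarith) ha0
      omega
  have key' : (P i).queryOverhead < (P i).n → ((P i).n : ℝ) ≤ 2 * (P i).s := fun h => by
    exact_mod_cast key h
  have hn0 : (0 : ℝ) ≤ (P i).n := Nat.cast_nonneg _
  have hl0 : (0 : ℝ) ≤ (P i).ell := Nat.cast_nonneg _
  refine ⟨fun h => by linarith [key' h], ?_⟩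
  rcases lt_or_ge (P i).queryOverhead (P i).n with h | h
  · have : ((P i).s : ℝ) ≤ (P i).queryOverhead := by
      exact_mod_cast Nat.le_add_left _ _
    linarith [key' h]
  · have : ((P i).n : ℝ) ≤ (P i).queryOverhead := by exact_mod_cast h
    linarith
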